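/- Let $1\le p<\infty$. The Fock space $\mathcal F^p$ is the space of entire functions $f:\mathbb C\to\mathbb C$ with $$\int_{\mathbb C}|f(z)|^p\,d\mu_{p\pi}(z)<\infty ,\qquad d\mu_\beta(z)=\frac{\beta}{2\pi}e^{-\frac{\beta}{2}|z|^2}\,dA(z),$$ where $dA$ is the Euclidean area measure. A countable (finite or infinite, possibly empty) family $Z=\{z_n\}$ of complex numbers, in which points may be repeated, is called a zero set for $\mathcal F^p$ if there is $f\in\mathcal F^p\setminus\{0\}$ whose zeros, counted with multiplicity, are exactly the members of $Z$; that is, for every $w\in\mathbb C$ the order of vanishing of $f$ at $w$ equals the number of indices $n$ with $z_n=w$. **Theorem 1.3.** Let $Z=\{z_n\}$ be a zero set for $\mathcal F^p$, $1\le p<\infty$. The following statements are equivalent: 1. every subfamily of $Z$ is a zero set for $\mathcal F^p$; 2. $\displaystyle\sum_{n:\,z_n\neq 0}\frac{1}{|z_n|^2}<\infty .$ -/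

import Mathlib

open MeasureTheory
open scoped ENNReal

namespace Fock

/-- The Gaussian measure `dμ_β(z) = (β / 2π) exp(-(β/2)|z|²) dA(z)` on `ℂ`, where `dA` is the
Euclidean area measure (for `β > 0`). -/
noncomputable def gaussianMeasure (β : ℝ) : Measure ℂ :=
  (volume : Measure ℂ).withDensity fun z =>
    ENNReal.ofReal (β / (2 * Real.pi) * Real.exp (-(β / 2) * ‖z‖ ^ 2))

/-- The Fock space `F^p = F^p_π`, as a set of functions: the entire functions `f` such that
`∫ |f|^p dμ_{pπ} < ∞`. -/
def fockSpace (p : ℝ) : Set (ℂ → ℂ) :=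
  {f | Differentiable ℂ f ∧ ∫⁻ z, ‖f z‖ₑ ^ p ∂(gaussianMeasure (p * Real.pi)) < ∞}

/-- The family `z = (z_i)`, in which a point may be repeated, is a zero set for `F^p`: some nonzero
`f ∈ F^p` has at every point `w` a zero whose multiplicity is exactly the number of times that `w`
is listed in the family (in particular `f w ≠ 0` when `w` is not listed). -/
def IsZeroSet (p : ℝ) {ι : Type*} (z : ι → ℂ) : Prop :=
  ∃ f ∈ fockSpace p, f ≠ 0 ∧ ∀ w : ℂ, analyticOrderAt f w = Set.encard {i | z i = w}

end Fock

/-! If `∑ 1/|z_n|²` converges, so does the sum over any subfamily, and a power of `z` times the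
genus-one canonical product has exactly the prescribed zeros. After finitely many factors are split
off, the remaining sum is at most 1, so the product is bounded by `exp(A|z| + |z|²/2)`. The Gaussian
weight tolerates any quadratic coefficient below `π/2`, hence the product lies in the Fock space
(`isZeroSet_of_summable`). That `Z` itself is a zero set is used here only to make the multiplicity
of the origin finite.

Conversely, Fock functions grow at most like `exp(C(1 + |z|²))` (`exists_norm_le_exp`), so by
Lindelöf's condition (`exists_norm_sum_inv_sq_le`) the sums of `1/z_n²` over `|z_n| < R` are bounded
in `R` for a zero set avoiding 0. Such sums may be bounded through cancellation only. Passing to the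
subfamily with `Re(c/z_n²) ≥ 0` rules that out, and `c = ±1, ±i` together give absolute convergence.
-/

/-! ### Genus-one canonical products: convergence, growth, zeros. -/

open Filter Topology in
theorem Summable.finite_setOf_eq_of_inv_sq {κ : Type*} {u : κ → ℂ}
    (hu : Summable fun i => 1 / ‖u i‖ ^ 2) {w : ℂ} (hw : w ≠ 0) : {i | u i = w}.Finite := by
  have h := hu.tendsto_cofinite_zero
  have hpos : 0 < 1 / ‖w‖ ^ 2 := by have := norm_pos_iff.2 hw; positivity
  have := h.eventually (Iio_mem_nhds hpos)
  refine (Filter.eventually_cofinite.1 this).subset fun i hi => ?_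
  simp only [Set.mem_ofPred_eq] at hi
  simp [hi]

/-- The Weierstrass elementary factor of genus one. -/
noncomputable def elementaryFactor (v : ℂ) : ℂ := (1 - v) * Complex.exp v

namespace elementaryFactor

@[simp] theorem apply_zero : elementaryFactor 0 = 1 := by simp [elementaryFactor]

theorem differentiable : Differentiable ℂ elementaryFactor := by
  unfold elementaryFactor
  fun_prop

theorem eq_zero_iff {v : ℂ} : elementaryFactor v = 0 ↔ v = 1 := by
  rw [elementaryFactor, mul_eq_zero, or_iff_left (Complex.exp_ne_zero v), sub_eq_zero, eq_comm]

/-- Second-order contact with 1 at the origin is what lets summability of `1/|u i|²` control the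
product. -/
theorem norm_sub_one_le {v : ℂ} (hv : ‖v‖ ≤ 1) : ‖elementaryFactor v - 1‖ ≤ 3 * ‖v‖ ^ 2 := by
  have h1 := Complex.norm_exp_sub_one_sub_id_le hv
  have h2 := Complex.norm_exp_sub_one_le hv
  have : elementaryFactor v - 1 = (Complex.exp v - 1 - v) - v * (Complex.exp v - 1) := by
    unfold elementaryFactor; ring
  rw [this]
  calc _ ≤ ‖Complex.exp v - 1 - v‖ + ‖v‖ * ‖Complex.exp v - 1‖ := by
        rw [← norm_mul]; exact norm_sub_le _ _
    _ ≤ ‖v‖ ^ 2 + ‖v‖ * (2 * ‖v‖) := by gcongr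
    _ = _ := by ring

/-- Apply `1 + t ≤ exp t` to `|1 - v|² = 1 + (|v|² - 2 Re v)`; after a square root the factor
`exp(Re v)` cancels the linear term. -/
theorem norm_le_exp_sq (v : ℂ) : ‖elementaryFactor v‖ ≤ Real.exp (‖v‖ ^ 2 / 2) := by
  rw [elementaryFactor, norm_mul, Complex.norm_exp]
  have h : ‖1 - v‖ ^ 2 ≤ Real.exp (‖v‖ ^ 2 - 2 * v.re) := by
    have h1 : ‖1 - v‖ ^ 2 = ‖v‖ ^ 2 - 2 * v.re + 1 := by
      rw [Complex.sq_norm, Complex.sq_norm, Complex.normSq_apply, Complex.normSq_apply]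
      simp; ring
    rw [h1]; exact Real.add_one_le_exp _
  have h2 : ‖1 - v‖ ≤ Real.exp ((‖v‖ ^ 2 - 2 * v.re) / 2) := by
    refine le_of_sq_le_sq ?_ (by positivity)
    rw [← Real.exp_nat_mul, Nat.cast_ofNat, mul_div_cancel₀ _ two_ne_zero]
    exact h
  calc _ ≤ Real.exp ((‖v‖ ^ 2 - 2 * v.re) / 2) * Real.exp v.re := by gcongr
    _ = _ := by rw [← Real.exp_add]; congr 1; ring

theorem norm_le_exp (v : ℂ) : ‖elementaryFactor v‖ ≤ Real.exp (2 * ‖v‖) := by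
  rw [elementaryFactor, norm_mul, Complex.norm_exp, two_mul, Real.exp_add]
  gcongr
  · calc ‖1 - v‖ ≤ ‖(1 : ℂ)‖ + ‖v‖ := norm_sub_le _ _
      _ ≤ _ := by simpa [add_comm] using Real.add_one_le_exp ‖v‖
  · exact Complex.re_le_norm v

end elementaryFactor

/-- The canonical product of genus one; indices with `u i = 0` contribute the factor `1`. -/
noncomputable def canonicalProduct {κ : Type*} (u : κ → ℂ) (z : ℂ) : ℂ :=
  ∏' i, elementaryFactor (z / u i)

namespace canonicalProduct

variable {κ : Type*} {u : κ → ℂ}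

open Filter Topology in
theorem eventually_norm_sub_one_le (hu : Summable fun i => 1 / ‖u i‖ ^ 2) (R : ℝ) :
    ∀ᶠ i in cofinite, ∀ z ∈ Metric.ball (0 : ℂ) R,
      ‖elementaryFactor (z / u i) - 1‖ ≤ 3 * R ^ 2 * (1 / ‖u i‖ ^ 2) := by
  have h := (hu.mul_left (R ^ 2)).tendsto_cofinite_zero.eventually (Iio_mem_nhds one_pos)
  filter_upwards [h] with i hi z hz
  have hz : ‖z‖ < R := by simpa using hz
  have h1 : ‖z / u i‖ ^ 2 ≤ R ^ 2 * (1 / ‖u i‖ ^ 2) := by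
    rw [norm_div, div_pow, div_eq_mul_one_div]
    gcongr
  have h2 : ‖z / u i‖ ≤ 1 := by
    have : ‖z / u i‖ ^ 2 ≤ 1 ^ 2 := by
      have hi : R ^ 2 * (1 / ‖u i‖ ^ 2) < 1 := hi
      linarith
    exact le_of_sq_le_sq this zero_le_one
  linarith [elementaryFactor.norm_sub_one_le h2]

theorem summable_norm (hu : Summable fun i => 1 / ‖u i‖ ^ 2) (z : ℂ) :
    Summable fun i => ‖elementaryFactor (z / u i) - 1‖ := by
  refine Summable.of_norm_bounded_eventually (hu.mul_left (3 * (‖z‖ + 1) ^ 2)) ?_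
  filter_upwards [eventually_norm_sub_one_le hu (‖z‖ + 1)] with i hi
  simpa using hi z (by simp)

theorem multipliable (hu : Summable fun i => 1 / ‖u i‖ ^ 2) (z : ℂ) :
    Multipliable fun i => elementaryFactor (z / u i) := by
  simpa using multipliable_one_add_of_summable (summable_norm hu z)

theorem differentiable (hu : Summable fun i => 1 / ‖u i‖ ^ 2) :
    Differentiable ℂ (canonicalProduct u) := by
  intro z
  have hd : ∀ i, Differentiable ℂ fun z => elementaryFactor (z / u i) := fun i =>
    elementaryFactor.differentiable.comp (differentiable_id.div_const _)
  have h := Summable.hasProdLocallyUniformlyOn_one_add (K := Metric.ball (0 : ℂ) (‖z‖ + 1))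
    (f := fun i z => elementaryFactor (z / u i) - 1) Metric.isOpen_ball
    (hu.mul_left (3 * (‖z‖ + 1) ^ 2)) (eventually_norm_sub_one_le hu _)
    fun i => ((hd i).continuous.sub continuous_const).continuousOn
  simp only [add_sub_cancel] at h
  have h2 := (hasProdLocallyUniformlyOn_iff_tendstoLocallyUniformlyOn.1 h).differentiableOn
    (.of_forall fun s => Differentiable.differentiableOn (by fun_prop)) Metric.isOpen_ball
  exact h2.differentiableAt (Metric.isOpen_ball.mem_nhds (by simp))

/-- The origin is a separate case because entries `u i = 0` are allowed; at 0 every factor equals 1.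
-/
theorem ne_zero (hu : Summable fun i => 1 / ‖u i‖ ^ 2) {w : ℂ}
    (hw : w = 0 ∨ ∀ i, u i ≠ w) : canonicalProduct u w ≠ 0 := by
  have := tprod_one_add_ne_zero_of_summable (f := fun i => elementaryFactor (w / u i) - 1) ?_
    (summable_norm hu w)
  · simpa [canonicalProduct] using this
  · intro i
    rw [add_sub_cancel, Ne, elementaryFactor.eq_zero_iff]
    rcases hw with rfl | hw
    · simp
    · intro h
      have h0 : u i ≠ 0 := by rintro h0; simp [h0] at h
      exact hw i ((div_eq_one_iff_eq h0).1 h).symm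

theorem norm_le (hu : Summable fun i => 1 / ‖u i‖ ^ 2) {B : ℝ}
    (hB : ∀ t : Finset κ, ∑ i ∈ t, 1 / ‖u i‖ ^ 2 ≤ B) (z : ℂ) :
    ‖canonicalProduct u z‖ ≤ Real.exp (B * ‖z‖ ^ 2 / 2) := by
  refine le_of_tendsto (multipliable hu z).hasProd.norm (.of_forall fun t => ?_)
  calc ∏ i ∈ t, ‖elementaryFactor (z / u i)‖ ≤ ∏ i ∈ t, Real.exp (‖z / u i‖ ^ 2 / 2) :=
        Finset.prod_le_prod (fun _ _ => norm_nonneg _) fun _ _ => elementaryFactor.norm_le_exp_sq _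
    _ = Real.exp ((∑ i ∈ t, 1 / ‖u i‖ ^ 2) * ‖z‖ ^ 2 / 2) := by
        rw [← Real.exp_sum, Finset.sum_mul, Finset.sum_div]
        congr 1
        refine Finset.sum_congr rfl fun i _ => ?_
        rw [norm_div]; ring
    _ ≤ _ := by gcongr; exact hB t

-- Setting entries to 0 deletes their factors without changing the index type: `z / 0 = 0` gives the
-- factor 1, and `1 / 0 ^ 2 = 0` contributes nothing to the sum.
open scoped Classical in
theorem summable_replace (hu : Summable fun i => 1 / ‖u i‖ ^ 2) (T : Finset κ) :
    Summable fun i => 1 / ‖if i ∈ T then 0 else u i‖ ^ 2 := by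
  refine hu.of_nonneg_of_le (fun i => by positivity) fun i => ?_
  split_ifs
  · simp
  · rfl

open scoped Classical in
theorem eq_prod_mul (hu : Summable fun i => 1 / ‖u i‖ ^ 2) (T : Finset κ) (z : ℂ) :
    canonicalProduct u z = (∏ i ∈ T, elementaryFactor (z / u i)) *
      canonicalProduct (fun i => if i ∈ T then 0 else u i) z := by
  have h1 : ∏ i ∈ T, elementaryFactor (z / u i) =
      ∏' i, if i ∈ T then elementaryFactor (z / u i) else 1 := by
    rw [tprod_eq_prod (s := T) (fun i hi => if_neg hi)]
    exact Finset.prod_congr rfl fun i hi => (if_pos hi).symm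
  have h2 : Multipliable fun i => if i ∈ T then elementaryFactor (z / u i) else 1 :=
    multipliable_of_ne_finset_one (s := T) fun i hi => if_neg hi
  rw [h1, canonicalProduct, canonicalProduct,
    ← h2.tprod_mul (multipliable (summable_replace hu T) z)]
  refine tprod_congr fun i => ?_
  split_ifs <;> simp

/-- The quadratic coefficient is 1/2 however large the sum is: the finitely many factors carrying
most of it cost only `exp(A|z|)`, and the remaining sum is at most 1. -/
theorem exists_norm_le (hu : Summable fun i => 1 / ‖u i‖ ^ 2) :
    ∃ A : ℝ, ∀ z, ‖canonicalProduct u z‖ ≤ Real.exp (A * ‖z‖ + ‖z‖ ^ 2 / 2) := by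
  classical
  obtain ⟨T, hT⟩ := summable_iff_vanishing_norm.1 hu 1 one_pos
  refine ⟨∑ i ∈ T, 2 / ‖u i‖, fun z => ?_⟩
  have hB : ∀ t : Finset κ, ∑ i ∈ t, 1 / ‖if i ∈ T then 0 else u i‖ ^ 2 ≤ 1 := fun t => by
    have h := (le_abs_self _).trans (hT (t \ T) Finset.sdiff_disjoint).le
    refine le_trans (le_of_eq ?_) h
    symm
    refine Finset.sum_subset_zero_on_sdiff Finset.sdiff_subset (fun i hi => ?_) fun i hi => ?_
    · have : i ∈ T := by simp at hi; tauto
      simp [this]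
    · rw [if_neg (Finset.mem_sdiff.1 hi).2]
  rw [eq_prod_mul hu T z, norm_mul, norm_prod, Real.exp_add]
  gcongr
  · calc ∏ i ∈ T, ‖elementaryFactor (z / u i)‖ ≤ ∏ i ∈ T, Real.exp (2 * ‖z / u i‖) :=
        Finset.prod_le_prod (fun _ _ => norm_nonneg _) fun _ _ => elementaryFactor.norm_le_exp _
      _ = _ := by
        rw [← Real.exp_sum, Finset.sum_mul]
        congr 1
        refine Finset.sum_congr rfl fun i _ => ?_
        rw [norm_div]; ring
  · simpa using norm_le (summable_replace hu T) hB z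

theorem analyticOrderAt_elementaryFactor {w : ℂ} (hw : w ≠ 0) :
    analyticOrderAt (fun z => elementaryFactor (z / w)) w = 1 := by
  have hd : Differentiable ℂ fun z => elementaryFactor (z / w) :=
    elementaryFactor.differentiable.comp (differentiable_id.div_const _)
  refine (hd.analyticAt w).analyticOrderAt_eq_one_of_zero_deriv_ne_zero ?_ ?_
  · simp [elementaryFactor.eq_zero_iff, hw]
  · have : HasDerivAt (fun z => elementaryFactor (z / w))
        (-(1 / w) * Complex.exp (w / w) + (1 - w / w) * (Complex.exp (w / w) * (1 / w))) w := by
      have h := (hasDerivAt_id w).div_const w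
      exact (h.const_sub 1).mul h.cexp
    rw [this.deriv]
    simp [hw]

/-- Only finitely many entries equal `w`. Their factors each have a simple zero there, and the
product of the others does not vanish at `w`. -/
theorem analyticOrderAt_eq (hu : Summable fun i => 1 / ‖u i‖ ^ 2) {w : ℂ} (hw : w ≠ 0) :
    analyticOrderAt (canonicalProduct u) w = {i | u i = w}.encard := by
  classical
  have hfin := hu.finite_setOf_eq_of_inv_sq hw
  set T := hfin.toFinset with hT
  have hmem : ∀ i, i ∈ T ↔ u i = w := fun i => by simp [hT]
  have hs := summable_replace hu T
  have hne : canonicalProduct (fun i => if i ∈ T then 0 else u i) w ≠ 0 := by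
    refine ne_zero hs (.inr fun i => ?_)
    split_ifs with h
    · exact hw.symm
    · exact fun h' => h ((hmem i).2 h')
  have heq : canonicalProduct u = (fun z => elementaryFactor (z / w)) ^ T.card *
      canonicalProduct (fun i => if i ∈ T then 0 else u i) := by
    funext z
    rw [eq_prod_mul hu T z, Pi.mul_apply, Pi.pow_apply]
    congr 1
    rw [← Finset.prod_const]
    exact Finset.prod_congr rfl fun i hi => by rw [(hmem i).1 hi]
  have hE : AnalyticAt ℂ (fun z => elementaryFactor (z / w)) w :=
    (elementaryFactor.differentiable.comp (differentiable_id.div_const _)).analyticAt w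
  rw [heq, analyticOrderAt_mul (hE.pow _) ((differentiable hs).analyticAt w),
    analyticOrderAt_pow hE, analyticOrderAt_elementaryFactor hw,
    ((differentiable hs).analyticAt w).analyticOrderAt_eq_zero.2 hne,
    hfin.encard_eq_coe_toFinset_card]
  simp [hT]

end canonicalProduct

/-! ### From summability to membership in the Fock space. -/

namespace Fock

/-- The integrand is dominated by a constant times `exp(-p(π/2 - 1)|z|²)`, and `π/2 > 1`. -/
theorem mem_fockSpace_of_norm_le {p : ℝ} (hp : 1 ≤ p) {g : ℂ → ℂ} (hg : Differentiable ℂ g)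
    {C : ℝ} (hC : ∀ z, ‖g z‖ ≤ Real.exp (C + ‖z‖ ^ 2)) : g ∈ fockSpace p := by
  have hp0 : 0 < p := by linarith
  have hpi := Real.pi_gt_three
  have hb : 0 < p * (Real.pi / 2 - 1) := by apply mul_pos hp0; linarith
  refine ⟨hg, ?_⟩
  have hint : Integrable fun z : ℂ => p * Real.pi / (2 * Real.pi) * Real.exp (p * C) *
      Real.exp (-(p * (Real.pi / 2 - 1)) * ‖z‖ ^ 2) := by
    refine Integrable.const_mul ?_ _
    have := (GaussianFourier.integrable_cexp_neg_mul_sq_norm_add (V := ℂ)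
      (b := ((p * (Real.pi / 2 - 1) : ℝ) : ℂ)) (by rwa [Complex.ofReal_re]) 0 0).norm
    refine this.congr (.of_forall fun z => ?_)
    simp only [Complex.norm_exp, zero_mul, add_zero, ← Complex.ofReal_pow, ← Complex.ofReal_neg,
      ← Complex.ofReal_mul, Complex.ofReal_re]
  rw [gaussianMeasure, lintegral_withDensity_eq_lintegral_mul₀ (by fun_prop)
    (hg.continuous.enorm.measurable.pow_const p).aemeasurable]
  refine lt_of_le_of_lt (lintegral_mono fun z => ?_) hint.lintegral_lt_top
  have h1 : ‖g z‖ₑ ^ p ≤ ENNReal.ofReal (Real.exp (p * C + p * ‖z‖ ^ 2)) := by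
    rw [← ofReal_norm, ENNReal.ofReal_rpow_of_nonneg (norm_nonneg _) hp0.le]
    refine ENNReal.ofReal_le_ofReal ?_
    calc ‖g z‖ ^ p ≤ Real.exp (C + ‖z‖ ^ 2) ^ p :=
          Real.rpow_le_rpow (norm_nonneg _) (hC z) hp0.le
      _ = _ := by rw [← Real.exp_mul]; ring_nf
  simp only [Pi.mul_apply]
  refine (mul_le_mul_right h1 _).trans ?_
  rw [← ENNReal.ofReal_mul (by positivity)]
  refine ENNReal.ofReal_le_ofReal (le_of_eq ?_)
  rw [mul_assoc, mul_assoc, ← Real.exp_add, ← Real.exp_add]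
  congr 2
  ring

theorem isZeroSet_of_summable {p : ℝ} (hp : 1 ≤ p) {κ : Type*} {u : κ → ℂ}
    (h0 : {i | u i = 0}.Finite) (hu : Summable fun i => 1 / ‖u i‖ ^ 2) : IsZeroSet p u := by
  obtain ⟨A, hA⟩ := canonicalProduct.exists_norm_le hu
  have hd := canonicalProduct.differentiable hu
  set k := h0.toFinset.card
  have hg : Differentiable ℂ ((fun z : ℂ => z) ^ k * canonicalProduct u) :=
    (differentiable_id.pow k).mul hd
  have hord : ∀ w, analyticOrderAt ((fun z : ℂ => z) ^ k * canonicalProduct u) w =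
      {i | u i = w}.encard := by
    intro w
    have hid : AnalyticAt ℂ (fun z : ℂ => z) w := analyticAt_id
    rw [analyticOrderAt_mul (hid.pow k) (hd.analyticAt w), analyticOrderAt_pow hid]
    by_cases hw : w = 0
    · subst hw
      rw [(hd.analyticAt 0).analyticOrderAt_eq_zero.2 (canonicalProduct.ne_zero hu (.inl rfl)),
        h0.encard_eq_coe_toFinset_card]
      have : analyticOrderAt (fun z : ℂ => z) 0 = 1 := analyticOrderAt_id
      simp [this, k]
    · rw [canonicalProduct.analyticOrderAt_eq hu hw, hid.analyticOrderAt_eq_zero.2 hw]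
      simp
  -- The constant comes from `(k + A) r ≤ (k + A)²/2 + r²/2` with `r = |z|`.
  refine ⟨_, mem_fockSpace_of_norm_le hp hg (C := (k + A) ^ 2 / 2) fun z => ?_, ?_, hord⟩
  · have h1 : ‖z‖ ^ k ≤ Real.exp (k * ‖z‖) := by
      rw [Real.exp_nat_mul]
      gcongr
      linarith [Real.add_one_le_exp ‖z‖]
    calc ‖((fun z : ℂ => z) ^ k * canonicalProduct u) z‖ = ‖z‖ ^ k * ‖canonicalProduct u z‖ := by
          simp
      _ ≤ Real.exp (k * ‖z‖) * Real.exp (A * ‖z‖ + ‖z‖ ^ 2 / 2) := by gcongr; exact hA z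
      _ ≤ _ := by
          rw [← Real.exp_add, Real.exp_le_exp]
          nlinarith [sq_nonneg (k + A - ‖z‖)]
  -- The zero function would have infinite order at 0, where only finitely many entries are listed.
  · intro h
    have := hord 0
    rw [h, h0.encard_eq_coe_toFinset_card] at this
    have h2 : analyticOrderAt (0 : ℂ → ℂ) 0 = ⊤ := analyticOrderAt_eq_top.2 (by simp)
    rw [h2] at this
    exact ENat.top_ne_natCast _ this

end Fock

/-! ### Pointwise growth of Fock functions. -/

namespace Fock

theorem two_pi_mul_enorm_le_lintegral_circle {f : ℂ → ℂ} (hf : Differentiable ℂ f) (w : ℂ) (r : ℝ) :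
    ENNReal.ofReal (2 * Real.pi) * ‖f w‖ₑ ≤
      ∫⁻ θ in Set.Ioo (-Real.pi) Real.pi, ‖f (circleMap w r θ)‖ₑ := by
  have hpi := Real.pi_pos
  have h1 : Real.circleAverage f w r = f w := hf.diffContOnCl.circleAverage
  rw [Real.circleAverage_eq_integral_add (-Real.pi),
    intervalIntegral.integral_comp_add_right (fun θ => f (circleMap w r θ)),
    inv_smul_eq_iff₀ (by positivity)] at h1
  have h2 : ENNReal.ofReal (2 * Real.pi) * ‖f w‖ₑ = ‖(2 * Real.pi) • f w‖ₑ := by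
    rw [enorm_smul, Real.enorm_eq_ofReal (by positivity)]
  rw [h2, ← h1, show 0 + -Real.pi = -Real.pi by ring, show 2 * Real.pi + -Real.pi = Real.pi by ring,
    intervalIntegral.integral_of_le (by linarith), integral_Ioc_eq_integral_Ioo]
  exact enorm_integral_le_lintegral_enorm _

/-- Polar integration of the circle estimate, restricted to radii in `(1/2, 1)` and with the
Jacobian `r` bounded below by 1/2. This loses a factor 2 against the area `π`, which is harmless. -/
theorem half_pi_mul_enorm_le_lintegral_ball {f : ℂ → ℂ} (hf : Differentiable ℂ f) (w : ℂ) :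
    ENNReal.ofReal (Real.pi / 2) * ‖f w‖ₑ ≤ ∫⁻ z in Metric.ball w 1, ‖f z‖ₑ := by
  have hpi := Real.pi_pos
  have hmeas : Measurable fun z => ‖f z‖ₑ := hf.continuous.enorm.measurable
  have h1 : ∫⁻ z in Metric.ball w 1, ‖f z‖ₑ =
      ∫⁻ z, (Metric.ball w 1).indicator (fun z => ‖f z‖ₑ) (w + z) := by
    rw [lintegral_add_left_eq_self, lintegral_indicator Metric.isOpen_ball.measurableSet]
  have hG : Measurable ((Metric.ball w 1).indicator (fun z => ‖f z‖ₑ)) :=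
    hmeas.indicator Metric.isOpen_ball.measurableSet
  have hpol : Continuous fun x : ℝ × ℝ => w + Complex.polarCoord.symm x := by
    simp only [Complex.polarCoord_symm_apply]
    fun_prop
  rw [h1, ← Complex.lintegral_comp_polarCoord_symm, polarCoord_target, Measure.volume_eq_prod,
    ← Measure.prod_restrict, lintegral_prod _ (by
      simp only [smul_eq_mul]
      exact (measurable_fst.ennreal_ofReal.mul (hG.comp hpol.measurable)).aemeasurable)]
  have hsub : Set.Ioo (1 / 2 : ℝ) 1 ⊆ Set.Ioi 0 := fun r hr => by
    have := hr.1
    simp only [Set.mem_Ioi]; linarith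
  calc ENNReal.ofReal (Real.pi / 2) * ‖f w‖ₑ
      = ∫⁻ r in Set.Ioo (1 / 2 : ℝ) 1,
          ENNReal.ofReal (1 / 2) * (ENNReal.ofReal (2 * Real.pi) * ‖f w‖ₑ) := by
        rw [setLIntegral_const, Real.volume_Ioo, ← mul_assoc, mul_right_comm,
          ← ENNReal.ofReal_mul (by norm_num), ← ENNReal.ofReal_mul (by positivity)]
        congr 2; ring
    _ ≤ ∫⁻ r in Set.Ioo (1 / 2 : ℝ) 1, ∫⁻ θ in Set.Ioo (-Real.pi) Real.pi, ENNReal.ofReal r •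
          (Metric.ball w 1).indicator (fun z => ‖f z‖ₑ) (w + Complex.polarCoord.symm (r, θ)) := by
        refine setLIntegral_mono' measurableSet_Ioo fun r hr => ?_
        simp only [smul_eq_mul]
        rw [lintegral_const_mul' _ _ ENNReal.ofReal_ne_top]
        gcongr
        · exact hr.1.le
        · refine (two_pi_mul_enorm_le_lintegral_circle hf w r).trans (le_of_eq ?_)
          refine lintegral_congr fun θ => ?_
          have hz : w + Complex.polarCoord.symm (r, θ) = circleMap w r θ := by
            rw [Complex.polarCoord_symm_apply, circleMap, Complex.exp_mul_I]
            simp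
          rw [hz, Set.indicator_of_mem]
          rw [mem_ball_iff_norm, circleMap_sub_center, norm_circleMap_zero, abs_lt]
          exact ⟨by linarith [hr.1], hr.2⟩
    _ ≤ _ := lintegral_mono_set hsub

/-- The constant is the reciprocal of a lower bound for the Gaussian density on the disc, where `|z|
≤ |w| + 1`. -/
theorem setLIntegral_ball_le {p : ℝ} (hp : 1 ≤ p) (g : ℂ → ℝ≥0∞) (w : ℂ) :
    ∫⁻ z in Metric.ball w 1, g z ≤
      ENNReal.ofReal (2 / p * Real.exp (p * Real.pi / 2 * (‖w‖ + 1) ^ 2)) *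
        ∫⁻ z, g z ∂(gaussianMeasure (p * Real.pi)) := by
  have hpi := Real.pi_pos
  have hp0 : 0 < p := by linarith
  rw [gaussianMeasure, lintegral_withDensity_eq_lintegral_mul_non_measurable _ (by fun_prop)
    (.of_forall fun _ => ENNReal.ofReal_lt_top), ← lintegral_const_mul' _ _ ENNReal.ofReal_ne_top]
  refine (setLIntegral_mono' Metric.isOpen_ball.measurableSet fun z hz => ?_).trans
    (setLIntegral_le_lintegral (Metric.ball w 1) _)
  simp only [Pi.mul_apply]
  rw [← mul_assoc, ← ENNReal.ofReal_mul (by positivity)]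
  refine le_mul_of_one_le_left' ?_
  rw [ENNReal.one_le_ofReal]
  have hz' : ‖z‖ ≤ ‖w‖ + 1 := by
    have h1 : ‖z - w‖ < 1 := mem_ball_iff_norm.1 hz
    have h2 := norm_sub_norm_le z w
    linarith
  have h3 : ‖z‖ ^ 2 ≤ (‖w‖ + 1) ^ 2 := by gcongr
  have h4 : 2 / p * Real.exp (p * Real.pi / 2 * (‖w‖ + 1) ^ 2) *
      (p * Real.pi / (2 * Real.pi) * Real.exp (-(p * Real.pi / 2) * ‖z‖ ^ 2)) =
      Real.exp (p * Real.pi / 2 * ((‖w‖ + 1) ^ 2 - ‖z‖ ^ 2)) := by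
    rw [mul_mul_mul_comm, ← Real.exp_add]
    have : 2 / p * (p * Real.pi / (2 * Real.pi)) = 1 := by field_simp
    rw [this, one_mul]
    congr 1; ring
  rw [h4, Real.one_le_exp_iff]
  have : 0 ≤ (‖w‖ + 1) ^ 2 - ‖z‖ ^ 2 := by linarith
  positivity

theorem exists_norm_le_exp {p : ℝ} (hp : 1 ≤ p) {f : ℂ → ℂ} (hf : f ∈ fockSpace p) :
    ∃ C : ℝ, 0 < C ∧ ∀ z, ‖f z‖ ≤ Real.exp (C * (1 + ‖z‖ ^ 2)) := by
  have hpi := Real.pi_gt_three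
  have hp0 : 0 < p := by linarith
  obtain ⟨hd, hint⟩ := hf
  set I := ∫⁻ z, ‖f z‖ₑ ^ p ∂(gaussianMeasure (p * Real.pi)) with hI
  set J := I.toReal
  -- The constant combines `(|w| + 1)² ≤ 2(1 + |w|²)` with `2 + 2J ≤ exp(1 + 2J)`; only quadratic
  -- growth of the exponent matters later.
  refine ⟨p * Real.pi + 1 + 2 * J, by positivity, fun w => ?_⟩
  set X := Real.exp (p * Real.pi / 2 * (‖w‖ + 1) ^ 2) with hX
  have h1 : ENNReal.ofReal (Real.pi / 2) * ‖f w‖ₑ ≤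
      ENNReal.ofReal Real.pi + ENNReal.ofReal (2 / p * X) * I := by
    refine (half_pi_mul_enorm_le_lintegral_ball hd w).trans ?_
    -- The elementary inequality `t ≤ 1 + t ^ p` replaces Hölder.
    calc ∫⁻ z in Metric.ball w 1, ‖f z‖ₑ ≤ ∫⁻ z in Metric.ball w 1, (1 + ‖f z‖ₑ ^ p) := by
          refine lintegral_mono fun z => ?_
          rcases le_total ‖f z‖ₑ 1 with h | h
          · exact h.trans le_self_add
          · exact (ENNReal.le_rpow_self_of_one_le h hp).trans le_add_self
      _ = volume (Metric.ball w 1) + ∫⁻ z in Metric.ball w 1, ‖f z‖ₑ ^ p := by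
          rw [lintegral_add_left measurable_const, setLIntegral_one]
      _ ≤ _ := by
          gcongr
          · rw [Complex.volume_ball, ENNReal.ofReal_one, one_pow, one_mul, ← NNReal.coe_real_pi,
              ENNReal.ofReal_coe_nnreal]
          · exact setLIntegral_ball_le hp _ w
  have h2 : Real.pi / 2 * ‖f w‖ ≤ Real.pi + 2 / p * X * J := by
    have hI' : I = ENNReal.ofReal J := (ENNReal.ofReal_toReal hint.ne).symm
    rw [hI', ← ofReal_norm, ← ENNReal.ofReal_mul (by positivity), ← ENNReal.ofReal_mul (by positivity),
      ← ENNReal.ofReal_add (by positivity) (by positivity)] at h1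
    exact (ENNReal.ofReal_le_ofReal_iff (by positivity)).1 h1
  have hJ : 0 ≤ J := ENNReal.toReal_nonneg
  have hX1 : 1 ≤ X := Real.one_le_exp (by positivity)
  have h3 : ‖f w‖ ≤ (2 + 2 * J) * X := by
    have h5 : 2 / p * X * J ≤ 2 * X * J := by
      gcongr
      exact div_le_self (by norm_num) hp
    have h6 : 2 * X * J ≤ Real.pi / 2 * (2 * J * X) := by
      have : 0 ≤ X * J := by positivity
      nlinarith
    have h7 : Real.pi / 2 * ‖f w‖ ≤ Real.pi / 2 * ((2 + 2 * J) * X) := by nlinarith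
    exact le_of_mul_le_mul_left h7 (by positivity)
  refine h3.trans ?_
  have h4 : 2 + 2 * J ≤ Real.exp (1 + 2 * J) := by
    linarith [Real.add_one_le_exp (1 + 2 * J)]
  calc (2 + 2 * J) * X ≤ Real.exp (1 + 2 * J) * X := by gcongr
    _ = Real.exp (1 + 2 * J + p * Real.pi / 2 * (‖w‖ + 1) ^ 2) := by rw [Real.exp_add (1 + 2 * J), hX]
    _ ≤ _ := by
      rw [Real.exp_le_exp]
      have h8 : p * Real.pi / 2 * (‖w‖ + 1) ^ 2 ≤ p * Real.pi / 2 * (2 * (1 + ‖w‖ ^ 2)) := by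
        gcongr
        nlinarith [sq_nonneg (‖w‖ - 1)]
      have h9 : 0 ≤ (1 + 2 * J) * ‖w‖ ^ 2 := by positivity
      nlinarith

end Fock

open Filter Topology

/-! ### Dividing an entire function by its zeros in a disc. -/

section zeros

variable {ι : Type*}

open scoped Classical in
theorem analyticOrderAt_prod_sub (z : ι → ℂ) (s : Finset ι) (w : ℂ) :
    analyticOrderAt (fun x => ∏ i ∈ s, (x - z i)) w = (s.filter (z · = w)).card := by
  induction s using Finset.induction_on with
  | empty => simp [(analyticAt_const).analyticOrderAt_eq_zero]
  | insert a s ha ih =>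
    have heq : (fun x => ∏ i ∈ insert a s, (x - z i)) =
        (fun x => x - z a) * fun x => ∏ i ∈ s, (x - z i) := by
      funext x
      simp [Finset.prod_insert ha]
    have h1 : AnalyticAt ℂ (fun x => x - z a) w := by fun_prop
    have h2 : AnalyticAt ℂ (fun x => ∏ i ∈ s, (x - z i)) w := by fun_prop
    rw [heq, analyticOrderAt_mul h1 h2, ih, Finset.filter_insert]
    split_ifs with h
    · subst h
      rw [analyticOrderAt_id_sub_const_self, Finset.card_insert_of_notMem (by simp [ha])]
      push_cast
      exact add_comm _ _
    · rw [h1.analyticOrderAt_eq_zero.2 (sub_ne_zero.2 (Ne.symm h)), zero_add]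

-- Induction on `s`: the product so far accounts for fewer zeros at the new point than `f` has, so
-- the quotient vanishes there and `dslope` divides once more.
open scoped Classical in
theorem exists_eq_mul_prod_sub {f : ℂ → ℂ} (hf : Differentiable ℂ f) (z : ι → ℂ) (s : Finset ι)
    (h : ∀ w, ((s.filter (z · = w)).card : ℕ∞) ≤ analyticOrderAt f w) :
    ∃ Q : ℂ → ℂ, Differentiable ℂ Q ∧ ∀ x, f x = Q x * ∏ i ∈ s, (x - z i) := by
  induction s using Finset.induction_on with
  | empty => exact ⟨f, hf, by simp⟩
  | insert a s ha ih =>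
    obtain ⟨Q, hQ, hfQ⟩ := ih fun w => le_trans (by
      gcongr
      exact Finset.subset_insert a s) (h w)
    have hprod : AnalyticAt ℂ (fun x => ∏ i ∈ s, (x - z i)) (z a) := by fun_prop
    have hQa : Q (z a) = 0 := by
      by_contra hne
      have h1 := h (z a)
      have h2 : f = Q * fun x => ∏ i ∈ s, (x - z i) := funext hfQ
      rw [h2, analyticOrderAt_mul (hQ.analyticAt _) hprod, analyticOrderAt_prod_sub,
        (hQ.analyticAt _).analyticOrderAt_eq_zero.2 hne, zero_add, Finset.filter_insert,
        if_pos rfl, Finset.card_insert_of_notMem (by simp [ha])] at h1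
      have h3 := Nat.cast_le.1 h1
      omega
    refine ⟨dslope Q (z a), ?_, fun x => ?_⟩
    · rw [← differentiableOn_univ, Complex.differentiableOn_dslope univ_mem]
      exact hQ.differentiableOn
    · have h1 := sub_smul_dslope Q (z a) x
      rw [hQa, sub_zero, smul_eq_mul] at h1
      rw [hfQ x, ← h1, Finset.prod_insert ha]
      ring

variable {f : ℂ → ℂ} {z : ι → ℂ}

/-- By the identity theorem, zeros cannot accumulate in a compact disc and each has finite order. -/
theorem finite_setOf_norm_lt_of_analyticOrderAt (hf : Differentiable ℂ f)
    (hf0 : f ≠ 0) (hz : ∀ w, analyticOrderAt f w = {i | z i = w}.encard) (R : ℝ) :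
    {i | ‖z i‖ < R}.Finite := by
  have han : AnalyticOnNhd ℂ f Set.univ := fun w _ => hf.analyticAt w
  have hzero : {w | f w = 0 ∧ ‖w‖ ≤ R}.Finite := by
    by_contra hinf
    obtain ⟨x, -, hx⟩ := Set.Infinite.exists_accPt_of_subset_isCompact hinf
      (isCompact_closedBall (0 : ℂ) R) fun w hw => by simpa using hw.2
    refine hf0 (funext fun y => ?_)
    refine han.eqOn_zero_of_preconnected_of_frequently_eq_zero isPreconnected_univ
      (Set.mem_univ x) ?_ (Set.mem_univ y)
    exact (accPt_iff_frequently_nhdsNE.1 hx).mono fun w hw => hw.1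
  refine (hzero.biUnion (t := fun w => {i | z i = w}) fun w _ => ?_).subset fun i hi => ?_
  · rw [← Set.encard_ne_top_iff, ← hz w, Ne, analyticOrderAt_eq_top]
    intro h
    refine hf0 (funext fun y => ?_)
    exact han.eqOn_zero_of_preconnected_of_eventuallyEq_zero isPreconnected_univ (Set.mem_univ w) h
      (Set.mem_univ y)
  · simp only [Set.mem_iUnion]
    refine ⟨z i, ⟨?_, le_of_lt hi⟩, rfl⟩
    refine apply_eq_zero_of_analyticOrderAt_ne_zero ?_
    rw [hz, Set.encard_ne_zero]
    exact ⟨i, rfl⟩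

/-- Division of an entire function by all its zeros in an open disc. -/
theorem exists_eq_mul_prod_sub_of_norm_lt (hf : Differentiable ℂ f)
    (hf0 : f ≠ 0) (hz : ∀ w, analyticOrderAt f w = {i | z i = w}.encard) (R : ℝ) :
    ∃ s : Finset ι, (∀ i, i ∈ s ↔ ‖z i‖ < R) ∧ ∃ Q : ℂ → ℂ, Differentiable ℂ Q ∧
      (∀ x, f x = Q x * ∏ i ∈ s, (x - z i)) ∧ ∀ x ∈ Metric.ball (0 : ℂ) R, Q x ≠ 0 := by
  classical
  have hfin := finite_setOf_norm_lt_of_analyticOrderAt hf hf0 hz R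
  have hs : ∀ i, i ∈ hfin.toFinset ↔ ‖z i‖ < R := fun i => by simp
  set s := hfin.toFinset
  have hcard : ∀ w, ((s.filter (z · = w)).card : ℕ∞) = {i | ‖z i‖ < R ∧ z i = w}.encard := by
    intro w
    rw [← Set.encard_coe_eq_coe_finsetCard]
    congr 1
    ext i
    simp [hs]
  obtain ⟨Q, hQ, hfQ⟩ := exists_eq_mul_prod_sub hf z s fun w => by
    rw [hcard, hz]
    exact Set.encard_le_encard fun i hi => hi.2
  refine ⟨s, hs, Q, hQ, hfQ, fun x hx hQx => ?_⟩
  have hx' : ‖x‖ < R := by simpa using hx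
  have hprod : AnalyticAt ℂ (fun x => ∏ i ∈ s, (x - z i)) x := by fun_prop
  have h2 : f = Q * fun x => ∏ i ∈ s, (x - z i) := funext hfQ
  have h3 := hz x
  -- As `|x| < R`, all entries equal to `x` are indexed by `s`, so the product already exhausts the
  -- order of `f` at `x`.
  have h4 : {i | z i = x} = {i | ‖z i‖ < R ∧ z i = x} := by
    ext i
    simp only [Set.mem_ofPred_eq]
    exact ⟨fun h => ⟨h ▸ hx', h⟩, fun h => h.2⟩
  rw [h2, analyticOrderAt_mul (hQ.analyticAt _) hprod, analyticOrderAt_prod_sub, h4, ← hcard] at h3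
  have h5 : analyticOrderAt Q x ≠ 0 := (hQ.analyticAt x).analyticOrderAt_ne_zero.2 hQx
  have h6 : analyticOrderAt Q x + ((s.filter (z · = x)).card : ℕ∞) =
      0 + ((s.filter (z · = x)).card : ℕ∞) := by rw [h3, zero_add]
  exact h5 (ENat.add_left_injective_of_ne_top (ENat.natCast_ne_top _) h6)

end zeros

/-! ### Blaschke quotients and Lindelöf's condition. -/

section blaschke

variable {ι : Type*} {z : ι → ℂ} {s : Finset ι} {Q f : ℂ → ℂ} {R : ℝ}

open ComplexConjugate

/-- The quotient of `Q * ∏ (x - z i)` by the Blaschke product of the disc of radius `R` with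
zeros `z i`. -/
noncomputable def blaschkeQuotient (R : ℝ) (z : ι → ℂ) (s : Finset ι) (Q : ℂ → ℂ) (x : ℂ) : ℂ :=
  Q x * ∏ i ∈ s, ((R ^ 2 - conj (z i) * x) / R)

namespace blaschkeQuotient

theorem differentiable (hQ : Differentiable ℂ Q) : Differentiable ℂ (blaschkeQuotient R z s Q) := by
  unfold blaschkeQuotient
  fun_prop

theorem sq_sub_conj_mul_ne_zero {a x : ℂ} (ha : ‖a‖ < R) (hx : ‖x‖ ≤ R) :
    (R : ℂ) ^ 2 - conj a * x ≠ 0 := by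
  have hR : 0 < R := (norm_nonneg _).trans_lt ha
  intro h
  have h1 := congrArg norm (sub_eq_zero.1 h)
  rw [norm_mul, norm_pow, Complex.norm_real, RCLike.norm_conj, Real.norm_of_nonneg hR.le] at h1
  nlinarith [norm_nonneg x, norm_nonneg a]

theorem ne_zero (hs : ∀ i ∈ s, ‖z i‖ < R) {x : ℂ} (hx : ‖x‖ < R) (hQ : Q x ≠ 0) :
    blaschkeQuotient R z s Q x ≠ 0 := by
  have hR : 0 < R := (norm_nonneg _).trans_lt hx
  refine mul_ne_zero hQ (Finset.prod_ne_zero_iff.2 fun i hi => div_ne_zero ?_ ?_)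
  · exact sq_sub_conj_mul_ne_zero (hs i hi) hx.le
  · exact_mod_cast hR.ne'

/-- On `|x| = R`, `R² = x * conj x`, so each new factor is `x * conj (x - z i) / R`. -/
theorem norm_eq_on_sphere (hR : 0 < R) {x : ℂ} (hx : ‖x‖ = R) :
    ‖blaschkeQuotient R z s Q x‖ = ‖Q x * ∏ i ∈ s, (x - z i)‖ := by
  rw [blaschkeQuotient, norm_mul, norm_mul, norm_prod, norm_prod]
  congr 1
  refine Finset.prod_congr rfl fun i _ => ?_
  have h : (R : ℂ) ^ 2 - conj (z i) * x = x * conj (x - z i) := by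
    rw [map_sub, mul_sub, Complex.mul_conj, Complex.normSq_eq_norm_sq, hx]
    push_cast; ring
  rw [h, norm_div, norm_mul, RCLike.norm_conj, Complex.norm_real, Real.norm_of_nonneg hR.le, hx]
  field_simp

theorem norm_le (hR : 0 < R) (hQ : Differentiable ℂ Q) {M : ℝ}
    (hM : ∀ x : ℂ, ‖x‖ = R → ‖Q x * ∏ i ∈ s, (x - z i)‖ ≤ M) {x : ℂ} (hx : ‖x‖ ≤ R) :
    ‖blaschkeQuotient R z s Q x‖ ≤ M := by
  refine Complex.norm_le_of_forall_mem_frontier_norm_le (U := Metric.ball (0 : ℂ) R)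
    Metric.isBounded_ball (differentiable hQ).diffContOnCl (fun y hy => ?_) ?_
  · rw [frontier_ball _ hR.ne', mem_sphere_zero_iff_norm] at hy
    rw [norm_eq_on_sphere hR hy]
    exact hM y hy
  · rw [closure_ball _ hR.ne']
    simpa using hx

/-- A multiplicative form of Jensen's formula: at 0 each factor of modulus `|z i|` is replaced by
one of modulus `R`. -/
theorem prod_mul_norm_le (hR : 0 < R) (hs : ∀ i ∈ s, ‖z i‖ < R ∧ z i ≠ 0) :
    (∏ i ∈ s, R / ‖z i‖) * ‖Q 0 * ∏ i ∈ s, (0 - z i)‖ = ‖blaschkeQuotient R z s Q 0‖ := by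
  rw [blaschkeQuotient, norm_mul, norm_mul, norm_prod, norm_prod, mul_left_comm,
    ← Finset.prod_mul_distrib]
  congr 1
  refine Finset.prod_congr rfl fun i hi => ?_
  have h0 : ‖z i‖ ≠ 0 := norm_ne_zero_iff.2 (hs i hi).2
  have hR' : (R : ℂ) ≠ 0 := by exact_mod_cast hR.ne'
  rw [zero_sub, norm_neg, mul_zero, sub_zero, pow_two, mul_div_cancel_right₀ _ hR',
    Complex.norm_real, Real.norm_of_nonneg hR.le]
  field_simp

theorem norm_le_norm_apply_zero (hR : 0 < R) (hs : ∀ i ∈ s, ‖z i‖ < R ∧ z i ≠ 0) :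
    ‖Q 0 * ∏ i ∈ s, (0 - z i)‖ ≤ ‖blaschkeQuotient R z s Q 0‖ := by
  rw [← prod_mul_norm_le hR hs]
  refine le_mul_of_one_le_left (norm_nonneg _) ?_
  refine Finset.one_le_prod fun i hi => ?_
  have h0 : 0 < ‖z i‖ := norm_pos_iff.2 (hs i hi).2
  rw [one_le_div h0]
  exact (hs i hi).1.le

/-- In the Jensen product the indices of `t` contribute at least 2 each and the others at least 1;
this is used to count zeros. -/
theorem two_pow_card_mul_norm_le (hR : 0 < R) (hs : ∀ i ∈ s, ‖z i‖ < R ∧ z i ≠ 0)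
    {t : Finset ι} (hts : t ⊆ s) (ht : ∀ i ∈ t, ‖z i‖ ≤ R / 2) :
    2 ^ t.card * ‖Q 0 * ∏ i ∈ s, (0 - z i)‖ ≤ ‖blaschkeQuotient R z s Q 0‖ := by
  rw [← prod_mul_norm_le hR hs]
  gcongr
  have hpos : ∀ i ∈ s, 0 < ‖z i‖ := fun i hi => norm_pos_iff.2 (hs i hi).2
  calc (2 : ℝ) ^ t.card = ∏ i ∈ t, 2 := by simp
    _ ≤ ∏ i ∈ t, R / ‖z i‖ := by
      refine Finset.prod_le_prod (fun _ _ => zero_le_two) fun i hi => ?_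
      rw [le_div_iff₀ (hpos i (hts hi))]
      linarith [ht i hi]
    _ ≤ _ := by
      classical
      rw [← Finset.prod_sdiff hts]
      refine le_mul_of_one_le_left (Finset.prod_nonneg fun i _ => by positivity) ?_
      refine Finset.one_le_prod fun i hi => ?_
      have hi := (Finset.mem_sdiff.1 hi).1
      rw [one_le_div (hpos i hi)]
      exact (hs i hi).1.le

/-- Both logarithmic derivatives contain that of `Q`. They differ in the partial fractions `1/(x - z
i)` and `-conj (z i)/(R² - conj (z i) x)`, which are differentiated at 0. -/
theorem deriv_logDeriv_zero (hR : 0 < R) (hs : ∀ i ∈ s, ‖z i‖ < R ∧ z i ≠ 0)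
    (hQ : Differentiable ℂ Q) (hQ0 : Q 0 ≠ 0) (hf : ∀ x, f x = Q x * ∏ i ∈ s, (x - z i)) :
    deriv (logDeriv (blaschkeQuotient R z s Q)) 0 =
      deriv (logDeriv f) 0 + ∑ i ∈ s, (1 / z i ^ 2 - conj (z i) ^ 2 / R ^ 4) := by
  have hR' : (R : ℂ) ≠ 0 := by exact_mod_cast hR.ne'
  have hlogQ : DifferentiableAt ℂ (logDeriv Q) 0 :=
    ((hQ.analyticAt 0).deriv.differentiableAt).div (hQ 0) hQ0
  have hlf : logDeriv f =ᶠ[𝓝 0] fun x => logDeriv Q x + ∑ i ∈ s, (x - z i)⁻¹ := by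
    have h1 : ∀ᶠ x in 𝓝 (0 : ℂ), ∀ i ∈ s, x - z i ≠ 0 := by
      rw [Filter.eventually_all_finset]
      intro i hi
      have : ContinuousAt (fun x => x - z i) 0 := by fun_prop
      exact this.eventually_ne (by simpa using (hs i hi).2)
    filter_upwards [h1, hQ.continuous.continuousAt.eventually_ne hQ0] with x hx hQx
    have hff : f = fun x => Q x * ∏ i ∈ s, (x - z i) := funext hf
    rw [hff, logDeriv_mul x hQx (Finset.prod_ne_zero_iff.2 hx) (hQ x) (by fun_prop),
      logDeriv_prod hx (fun i _ => by fun_prop)]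
    congr 1
    refine Finset.sum_congr rfl fun i _ => ?_
    simp [logDeriv_apply]
  have hlF : logDeriv (blaschkeQuotient R z s Q) =ᶠ[𝓝 0]
      fun x => logDeriv Q x + ∑ i ∈ s, -conj (z i) * (R ^ 2 - conj (z i) * x)⁻¹ := by
    filter_upwards [Metric.ball_mem_nhds (0 : ℂ) hR,
      hQ.continuous.continuousAt.eventually_ne hQ0] with x hx hQx
    have hx : ‖x‖ < R := by simpa using hx
    have hne : ∀ i ∈ s, (R : ℂ) ^ 2 - conj (z i) * x ≠ 0 := fun i hi =>
      sq_sub_conj_mul_ne_zero (hs i hi).1 hx.le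
    have hne' : ∀ i ∈ s, ((R : ℂ) ^ 2 - conj (z i) * x) / R ≠ 0 := fun i hi =>
      div_ne_zero (hne i hi) hR'
    unfold blaschkeQuotient
    rw [logDeriv_mul x hQx (Finset.prod_ne_zero_iff.2 hne') (hQ x) (by fun_prop),
      logDeriv_prod (f := fun i x => ((R : ℂ) ^ 2 - conj (z i) * x) / R) hne'
        (fun i _ => by fun_prop)]
    congr 1
    refine Finset.sum_congr rfl fun i hi => ?_
    have hd : HasDerivAt (fun x : ℂ => ((R : ℂ) ^ 2 - conj (z i) * x) / R)
        (-(conj (z i) * 1) / R) x :=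
      (((hasDerivAt_id x).const_mul _).const_sub _).div_const _
    rw [logDeriv_apply, hd.deriv]
    have := hne i hi
    field_simp
  have hd1 : ∀ i ∈ s, HasDerivAt (fun x => (x - z i)⁻¹) (-(1 / z i ^ 2)) 0 := fun i hi => by
    refine (((hasDerivAt_id' (0 : ℂ)).sub_const (z i)).fun_inv
      (by simpa using (hs i hi).2)).congr_deriv ?_
    simp [neg_div]
  have hd2 : ∀ i ∈ s, HasDerivAt (fun x => -conj (z i) * ((R : ℂ) ^ 2 - conj (z i) * x)⁻¹)
      (-(conj (z i) ^ 2 / R ^ 4)) 0 := fun i _ => by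
    have h0 : (R : ℂ) ^ 2 - conj (z i) * 0 ≠ 0 := by simpa using hR'
    refine (((((hasDerivAt_id' (0 : ℂ)).const_mul (conj (z i))).const_sub ((R : ℂ) ^ 2)).fun_inv
      h0).const_mul (-conj (z i))).congr_deriv ?_
    simp
    field_simp
  rw [hlf.deriv_eq, hlF.deriv_eq,
    (hlogQ.hasDerivAt.fun_add (HasDerivAt.fun_sum hd1)).deriv,
    (hlogQ.hasDerivAt.fun_add (HasDerivAt.fun_sum hd2)).deriv, add_assoc, ← Finset.sum_add_distrib]
  congr 1
  refine Finset.sum_congr rfl fun i _ => ?_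
  ring

end blaschkeQuotient

/-- A zero-free `F` on the disc is `F 0 * exp h` with `h 0 = 0` and `Re h ≤ L`. Borel–Carathéodory
gives `|h| ≤ 2L` on `|x| = R/2`, and Cauchy's estimate for the second derivative is `2! * 2L /
(R/2)² = 16L/R²`. -/
theorem norm_deriv_logDeriv_zero_le {F : ℂ → ℂ} (hF : Differentiable ℂ F) (hR : 0 < R)
    (hne : ∀ x : ℂ, ‖x‖ < R → F x ≠ 0) {L : ℝ} (hL : 0 < L)
    (hle : ∀ x : ℂ, ‖x‖ < R → ‖F x‖ ≤ ‖F 0‖ * Real.exp L) :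
    ‖deriv (logDeriv F) 0‖ ≤ 16 * L / R ^ 2 := by
  have hlog : DifferentiableOn ℂ (logDeriv F) (Metric.ball 0 R) := fun x hx =>
    (((hF.analyticAt x).deriv.differentiableAt).div (hF x)
      (hne x (by simpa using hx))).differentiableWithinAt
  obtain ⟨h, h0, hh⟩ := hlog.isExactOn_ball.with_val_at 0 0
  have hhd : DifferentiableOn ℂ h (Metric.ball 0 R) := fun x hx =>
    (hh x hx).differentiableAt.differentiableWithinAt
  have hconst : ∀ x ∈ Metric.ball (0 : ℂ) R, F x * Complex.exp (-h x) = F 0 := by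
    intro x hx
    have hder : ∀ y ∈ Metric.ball (0 : ℂ) R,
        HasDerivAt (fun x => F x * Complex.exp (-h x)) 0 y := fun y hy => by
      refine ((hF y).hasDerivAt.fun_mul (hh y hy).fun_neg.cexp).congr_deriv ?_
      have hy := hne y (by simpa using hy)
      rw [logDeriv_apply]
      field_simp
      ring
    have := Metric.isOpen_ball.is_const_of_deriv_eq_zero
      (convex_ball (0 : ℂ) R).isPreconnected
      (fun y hy => (hder y hy).differentiableAt.differentiableWithinAt)
      (fun y hy => (hder y hy).deriv) hx (Metric.mem_ball_self hR)
    simpa [h0] using this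
  have hre : Set.MapsTo h (Metric.ball 0 R) {w | w.re ≤ L} := by
    intro x hx
    have hx' : ‖x‖ < R := by simpa using hx
    have h1 : F x = F 0 * Complex.exp (h x) := by
      rw [← hconst x hx, mul_assoc, ← Complex.exp_add]; simp
    have h2 := hle x hx'
    rw [h1, norm_mul, Complex.norm_exp] at h2
    have h3 : 0 < ‖F 0‖ := norm_pos_iff.2 (hne 0 (by simpa using hR))
    exact Real.exp_le_exp.1 (le_of_mul_le_mul_left h2 h3)
  have hbound : ∀ x ∈ Metric.sphere (0 : ℂ) (R / 2), ‖h x‖ ≤ 2 * L := by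
    intro x hx
    have hx' : ‖x‖ = R / 2 := by simpa using hx
    have := Complex.borelCaratheodory_zero hL hhd hre hR (z := x)
      (by rw [mem_ball_zero_iff, hx']; linarith) h0
    refine this.trans (le_of_eq ?_)
    rw [hx']
    field_simp
    ring
  have hsub : Metric.closedBall (0 : ℂ) (R / 2) ⊆ Metric.ball 0 R :=
    Metric.closedBall_subset_ball (by linarith)
  have hcauchy := Complex.norm_iteratedDeriv_le_of_forall_mem_sphere_norm_le 2 (half_pos hR)
    ((hhd.mono hsub).diffContOnCl_ball le_rfl) hbound
  rw [iteratedDeriv_succ, iteratedDeriv_one] at hcauchy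
  have hev : deriv h =ᶠ[𝓝 0] logDeriv F := by
    filter_upwards [Metric.ball_mem_nhds (0 : ℂ) hR] with x hx
    exact (hh x hx).deriv
  rw [hev.deriv_eq] at hcauchy
  refine hcauchy.trans (le_of_eq ?_)
  simp [Nat.factorial]
  field_simp
  ring

end blaschke

/-- **Lindelöf's condition** for entire functions of order two and finite type. -/
theorem exists_norm_sum_inv_sq_le {ι : Type*} {f : ℂ → ℂ} {z : ι → ℂ} (hf : Differentiable ℂ f)
    (hf0 : f 0 ≠ 0) (hz : ∀ w, analyticOrderAt f w = {i | z i = w}.encard) {C : ℝ} (hC : 0 < C)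
    (hle : ∀ x, ‖f x‖ ≤ Real.exp (C * (1 + ‖x‖ ^ 2))) :
    ∃ K : ℝ, ∀ R : ℝ, 1 ≤ R → ∃ s : Finset ι, (∀ i, i ∈ s ↔ ‖z i‖ < R) ∧
      ‖∑ i ∈ s, 1 / z i ^ 2‖ ≤ K := by
  have hfne : f ≠ 0 := fun h => hf0 (by simp [h])
  have hzne : ∀ i, z i ≠ 0 := fun i hi => by
    have h1 := (hf.analyticAt 0).analyticOrderAt_eq_zero.2 hf0
    rw [hz, Set.encard_eq_zero] at h1
    exact (Set.eq_empty_iff_forall_notMem.1 h1 i) hi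
  -- `D` absorbs the size of `f 0`: since `exp(-D) ≤ |f 0|`, for `R ≥ 1` the growth bound becomes
  -- relative to `|f 0|` with exponent `(2C + D)R²`.
  set D := |Real.log ‖f 0‖|
  have hD : 0 ≤ D := abs_nonneg _
  have hfpos : 0 < ‖f 0‖ := norm_pos_iff.2 hf0
  have hf0le : Real.exp (-D) ≤ ‖f 0‖ := by
    rw [← Real.le_log_iff_exp_le hfpos]
    exact neg_abs_le _
  have hM : ∀ R : ℝ, 1 ≤ R → ∀ x : ℂ, ‖x‖ = R →
      ‖f x‖ ≤ ‖f 0‖ * Real.exp ((2 * C + D) * R ^ 2) := fun R hR x hx => by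
    refine (hle x).trans ?_
    calc Real.exp (C * (1 + ‖x‖ ^ 2)) ≤ Real.exp (-D + (2 * C + D) * R ^ 2) := by
          rw [Real.exp_le_exp, hx]
          have hR2 : 1 ≤ R ^ 2 := one_le_pow₀ hR
          nlinarith
      _ = Real.exp (-D) * Real.exp ((2 * C + D) * R ^ 2) := Real.exp_add _ _
      _ ≤ _ := by gcongr
  -- The three terms bound the second logarithmic derivative of the Blaschke quotient, that of `f`,
  -- and the conjugate sum.
  refine ⟨16 * (2 * C + D) + ‖deriv (logDeriv f) 0‖ + 8 * (2 * C + D), fun R hR => ?_⟩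
  have hR0 : 0 < R := by linarith
  obtain ⟨s, hs, Q, hQ, hfQ, hQne⟩ := exists_eq_mul_prod_sub_of_norm_lt hf hfne hz R
  obtain ⟨s', hs', Q', hQ', hfQ', hQne'⟩ := exists_eq_mul_prod_sub_of_norm_lt hf hfne hz (2 * R)
  refine ⟨s, hs, ?_⟩
  have hsz : ∀ i ∈ s, ‖z i‖ < R ∧ z i ≠ 0 := fun i hi => ⟨(hs i).1 hi, hzne i⟩
  have hsz' : ∀ i ∈ s', ‖z i‖ < 2 * R ∧ z i ≠ 0 := fun i hi => ⟨(hs' i).1 hi, hzne i⟩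
  -- Jensen count on the disc of radius `2R`: `2 ^ n ≤ exp(4(2C + D)R²)`, and `exp(1/2) ≤ 2`.
  have hcard : (s.card : ℝ) ≤ 8 * (2 * C + D) * R ^ 2 := by
    have h1 := blaschkeQuotient.two_pow_card_mul_norm_le (Q := Q') (by linarith) hsz' (t := s)
      (fun i hi => (hs' i).2 (by linarith [(hs i).1 hi]))
      fun i hi => by linarith [(hs i).1 hi]
    have h2 := blaschkeQuotient.norm_le (z := z) (s := s') (R := 2 * R) (by linarith) hQ' (x := 0)
      (fun x hx => by rw [← hfQ' x]; exact hM (2 * R) (by linarith) x hx) (by simp; linarith)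
    rw [← hfQ' 0] at h1
    have h3 : (2 : ℝ) ^ s.card ≤ Real.exp ((2 * C + D) * (2 * R) ^ 2) := by
      refine le_of_mul_le_mul_left ?_ hfpos
      linarith
    have h4 : Real.exp (s.card * (1 / 2)) ≤ 2 ^ s.card := by
      rw [Real.exp_nat_mul]
      gcongr
      rw [← Real.le_log_iff_exp_le two_pos]
      linarith [Real.log_two_gt_d9]
    have h5 := Real.exp_le_exp.1 (h4.trans h3)
    nlinarith
  have hder := norm_deriv_logDeriv_zero_le (blaschkeQuotient.differentiable (z := z) (s := s)
    (R := R) hQ) hR0 (fun x hx => blaschkeQuotient.ne_zero (fun i hi => (hsz i hi).1) hx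
      (hQne x (by simpa using hx))) (L := (2 * C + D) * R ^ 2) (by positivity) fun x hx => by
    refine (blaschkeQuotient.norm_le hR0 hQ (fun y hy => ?_) hx.le).trans
      (mul_le_mul_of_nonneg_right (blaschkeQuotient.norm_le_norm_apply_zero hR0 hsz) (by positivity))
    rw [← hfQ y, ← hfQ 0]
    exact hM R hR y hy
  rw [blaschkeQuotient.deriv_logDeriv_zero hR0 hsz hQ (hQne 0 (by simpa using hR0)) hfQ,
    Finset.sum_sub_distrib] at hder
  -- Each term is at most `1/R²`, and there are `O(R²)` of them.
  have hconj : ‖∑ i ∈ s, (starRingEnd ℂ) (z i) ^ 2 / (R : ℂ) ^ 4‖ ≤ 8 * (2 * C + D) := by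
    calc _ ≤ ∑ i ∈ s, ‖(starRingEnd ℂ) (z i) ^ 2 / (R : ℂ) ^ 4‖ := norm_sum_le _ _
      _ ≤ ∑ i ∈ s, 1 / R ^ 2 := Finset.sum_le_sum fun i hi => by
          rw [norm_div, norm_pow, norm_pow, RCLike.norm_conj, Complex.norm_real,
            Real.norm_of_nonneg hR0.le, div_le_div_iff₀ (by positivity) (by positivity), one_mul]
          calc ‖z i‖ ^ 2 * R ^ 2 ≤ R ^ 2 * R ^ 2 := by gcongr; exact (hsz i hi).1.le
            _ = R ^ 4 := by ring
      _ = s.card / R ^ 2 := by simp [div_eq_mul_inv]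
      _ ≤ _ := by rw [div_le_iff₀ (by positivity)]; exact hcard
  have hsimp : 16 * ((2 * C + D) * R ^ 2) / R ^ 2 = 16 * (2 * C + D) := by field_simp
  rw [hsimp] at hder
  set S := ∑ i ∈ s, 1 / z i ^ 2
  set T := ∑ i ∈ s, (starRingEnd ℂ) (z i) ^ 2 / (R : ℂ) ^ 4
  set A := deriv (logDeriv f) 0
  calc ‖S‖ = ‖(A + (S - T)) - A + T‖ := by congr 1; ring
    _ ≤ ‖A + (S - T)‖ + ‖A‖ + ‖T‖ := (norm_add_le _ _).trans (by gcongr; exact norm_sub_le _ _)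
    _ ≤ _ := by gcongr

/-! ### Absolute convergence from all subfamilies. -/

namespace Fock

/-- On the subfamily `S` all `Re(c/z²)` are nonnegative, so Lindelöf's bound on the sum over a disc
bounds every finite partial sum. Excluding zero entries from `S` gives `f 0 ≠ 0`. -/
theorem summable_max_re_of_forall_isZeroSet {p : ℝ} (hp : 1 ≤ p) {ι : Type*} {z : ι → ℂ}
    (h : ∀ S : Set ι, IsZeroSet p (fun i : S => z i)) (c : ℂ) :
    Summable fun i => max (c * (1 / z i ^ 2)).re 0 := by
  classical
  set S : Set ι := {i | z i ≠ 0 ∧ 0 ≤ (c * (1 / z i ^ 2)).re}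
  obtain ⟨f, hf, -, hord⟩ := h S
  have hf0 : f 0 ≠ 0 := by
    rw [← (hf.1.analyticAt 0).analyticOrderAt_eq_zero, hord, Set.encard_eq_zero]
    exact Set.eq_empty_iff_forall_notMem.2 fun i hi => i.2.1 hi
  obtain ⟨C, hC, hle⟩ := exists_norm_le_exp hp hf
  obtain ⟨K, hK⟩ := exists_norm_sum_inv_sq_le hf.1 hf0 hord hC hle
  refine summable_of_sum_le (c := ‖c‖ * K) (fun i => le_max_right _ _) fun T => ?_
  -- Large enough that the disc of radius `R` contains every `z i` with `i ∈ T`.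
  set R := 1 + ∑ i ∈ T, ‖z i‖
  have hR : 1 ≤ R := le_add_of_nonneg_right (Finset.sum_nonneg fun _ _ => norm_nonneg _)
  obtain ⟨s, hs, hsum⟩ := hK R hR
  have hterm : ∀ i, i ∉ S → max (c * (1 / z i ^ 2)).re 0 = 0 := fun i hi => by
    by_cases hz : z i = 0
    · simp [hz]
    · refine max_eq_right (le_of_lt ?_)
      by_contra hlt
      exact hi ⟨hz, not_lt.1 hlt⟩
  calc ∑ i ∈ T, max (c * (1 / z i ^ 2)).re 0
      = ∑ i ∈ T.subtype (· ∈ S), max (c * (1 / z i.1 ^ 2)).re 0 := by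
        refine Eq.trans ?_ (Finset.sum_subtype_eq_sum_filter (s := T) (p := (· ∈ S))
          (fun i => max (c * (1 / z i ^ 2)).re (0 : ℝ))).symm
        rw [Finset.sum_filter]
        refine Finset.sum_congr rfl fun i _ => ?_
        split_ifs with hi
        · rfl
        · exact hterm i hi
    _ ≤ ∑ i ∈ s, max (c * (1 / z i.1 ^ 2)).re (0 : ℝ) := by
        refine Finset.sum_le_sum_of_subset_of_nonneg (fun i hi => (hs i).2 ?_)
          fun i _ _ => le_max_right _ _
        have : ‖z i‖ ≤ ∑ i ∈ T, ‖z i‖ :=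
          Finset.single_le_sum (f := fun i => ‖z i‖) (fun _ _ => norm_nonneg _)
            (Finset.mem_subtype.1 hi)
        exact lt_of_le_of_lt this (lt_one_add _)
    _ = (c * ∑ i ∈ s, 1 / z i.1 ^ 2).re := by
        rw [Finset.mul_sum, Complex.re_sum]
        exact Finset.sum_congr rfl fun i _ => max_eq_left i.2.2
    _ ≤ ‖c * ∑ i ∈ s, 1 / z i.1 ^ 2‖ := Complex.re_le_norm _
    _ ≤ ‖c‖ * K := by rw [norm_mul]; gcongr

/-- With `w = 1/z²`, the choices `c = ±1, ±i` yield the positive and negative parts of `Re w` and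
`Im w`, and `|w| ≤ |Re w| + |Im w|`. -/
theorem summable_inv_sq_of_forall_isZeroSet {p : ℝ} (hp : 1 ≤ p) {ι : Type*} {z : ι → ℂ}
    (h : ∀ S : Set ι, IsZeroSet p (fun i : S => z i)) : Summable fun i => 1 / ‖z i‖ ^ 2 := by
  have hc := summable_max_re_of_forall_isZeroSet hp h
  refine (((hc 1).add (hc (-1))).add ((hc Complex.I).add (hc (-Complex.I)))).of_nonneg_of_le
    (fun i => by positivity) fun i => ?_
  set w := 1 / z i ^ 2 with hw
  have h1 : 1 / ‖z i‖ ^ 2 = ‖w‖ := by simp [hw]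
  rw [h1]
  refine (Complex.norm_le_abs_re_add_abs_im w).trans (add_le_add ?_ ?_)
  · simp only [one_mul, neg_mul, Complex.neg_re]
    exact abs_le'.2 ⟨le_add_of_le_of_nonneg (le_max_left _ _) (le_max_right _ _),
      le_add_of_nonneg_of_le (le_max_right _ _) (le_max_left _ _)⟩
  · simp only [neg_mul, Complex.neg_re, Complex.I_mul_re, neg_neg]
    exact abs_le'.2 ⟨le_add_of_nonneg_of_le (le_max_right _ _) (le_max_left _ _),
      le_add_of_le_of_nonneg (le_max_left _ _) (le_max_right _ _)⟩

theorem IsZeroSet.finite_setOf_eq {p : ℝ} {ι : Type*} {z : ι → ℂ} (hz : IsZeroSet p z) (w : ℂ) :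
    {i | z i = w}.Finite := by
  obtain ⟨f, hf, hf0, hord⟩ := hz
  refine (finite_setOf_norm_lt_of_analyticOrderAt hf.1 hf0 hord (‖w‖ + 1)).subset fun i hi => ?_
  have hi : z i = w := hi
  simp [hi]

end Fock

theorem theorem1p3 (p : ℝ) (hp : 1 ≤ p) {ι : Type*} [Countable ι] (z : ι → ℂ)
    (hz : Fock.IsZeroSet p z) :
    (∀ S : Set ι, Fock.IsZeroSet p (fun i : S => z i)) ↔
      Summable (fun i : {i : ι // z i ≠ 0} => 1 / ‖z i‖ ^ 2) := by
  constructor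
  · intro h
    exact (Fock.summable_inv_sq_of_forall_isZeroSet hp h).comp_injective Subtype.val_injective
  · intro h S
    -- Zero entries contribute `1 / 0 ^ 2 = 0`, so summing over all indices is equivalent to summing
    -- over the nonzero entries.
    have hall : Summable fun i => 1 / ‖z i‖ ^ 2 := by
      refine (Function.Injective.summable_iff Subtype.val_injective fun i hi => ?_).1 h
      have hi : z i = 0 := by simpa using hi
      simp [hi]
    refine Fock.isZeroSet_of_summable hp ?_ (hall.comp_injective Subtype.val_injective)
    exact (hz.finite_setOf_eq 0).preimage Subtype.val_injective.injOn
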